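/- Let $m,d,r\ge 1$ be integers, let $U\in\mathbb R^{m\times d}$ have orthonormal columns ($U^{T}U=I_d$) and rows $u_1^T,\dots,u_m^T$, and let $S\in\mathbb R^{d\times d}$ be diagonal with positive diagonal entries. Let $\|\cdot\|$ denote the spectral norm, let $\rho=\rho(S)=\|S\|_F^2/\|S\|^2$ be the stable rank and $\kappa=\kappa(S)=\sigma_{\max}(S)/\sigma_{\min}(S)$ the condition number of $S$. Let $\beta\in(0,1]$ and $\epsilon>0$, and let $p_1,\dots,p_m\ge 0$ with $\sum_t p_t=1$ satisfy $$p_t\ \ge\ \beta\,\frac{u_t^{T}S^2u_t}{\operatorname{trace}(S^2)}\qquad(t=1,\dots,m).$$ Let $t_1,\dots,t_r$ be i.i.d. random indices with $\Pr[t_j=t]=p_t$, and let $Q\in\mathbb R^{r\times m}$ be the random row-sampling matrix whose $j$-th row is $e_{t_j}^T/\sqrt{r\,p_{t_j}}$, where $e_1,\dots,e_m$ is the standard basis of $\mathbb R^m$. Write $$B_1=2d\exp\!\left(\frac{-r\epsilon^2}{2\left(\rho/\beta-\kappa^{-4}+\epsilon(\rho/\beta-\kappa^{-2})/3\right)}\right)\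 \ (\text{for } d\ge 2),\qquad B_2=2d\exp\!\left(\frac{-r\beta\epsilon^2}{4\rho}\right).$$ 1. (Symmetric orthonormal subspace sampling.) If $\epsilon\le 3$, $\delta>0$ and $r\ge\frac{4\rho}{\beta\epsilon^2}\ln\frac{2d}{\delta}$, then with probability at least $1-\delta$, $$\|S^2-SU^{T}Q^{T}QUS\|\le\epsilon\|S\|^2 .$$ 2. (Tail bounds.) If $d\ge 2$, then $$\Pr\left[\|S^2-SU^{T}Q^{T}QUS\|>\epsilon\|S\|^2\right]\le B_1 .$$ If $\epsilon\le 3$, then for every $d\ge1$ $$\Pr\left[\|S^2-SU^{T}Q^{T}QUS\|>\epsilon\|S\|^2\right]\le B_2 ,$$ and, if moreover $d\ge 2$, $B_1\le B_2$. -/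

import Mathlib

open MeasureTheory ProbabilityTheory Matrix
-- Matrices carry the spectral norm (operator norm for the Euclidean norms).
open scoped Matrix.Norms.L2Operator

noncomputable section

/-- Squared Frobenius norm: the sum of the squares of the entries. -/
def frobeniusNormSq {m n : ℕ} (A : Matrix (Fin m) (Fin n) ℝ) : ℝ :=
  ∑ i, ∑ j, A i j ^ 2

/-- Stable (numerical, soft) rank: squared Frobenius norm over squared spectral norm. -/
def stableRank {m n : ℕ} (A : Matrix (Fin m) (Fin n) ℝ) : ℝ :=
  frobeniusNormSq A / ‖A‖ ^ 2

/-- Condition number of a square matrix: largest over smallest singular value. Mathlib lists the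
singular values in decreasing order, starting at index `0`. -/
def condNumber {d : ℕ} (A : Matrix (Fin d) (Fin d) ℝ) : ℝ :=
  (Matrix.toEuclideanLin A).singularValues 0 / (Matrix.toEuclideanLin A).singularValues (d - 1)

/-- Probability weights on the row indices. -/
def IsProbVector {m : ℕ} (p : Fin m → ℝ) : Prop :=
  (∀ t, 0 ≤ p t) ∧ ∑ t, p t = 1

/-- The random row indices `τ 0, …, τ (r - 1)` are independent, each with law `p`. -/
structure IsIIDSample {Ω : Type*} [MeasurableSpace Ω] (μ : Measure Ω) {m r : ℕ}
    (p : Fin m → ℝ) (τ : Fin r → Ω → Fin m) : Prop where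
  measurable : ∀ j, Measurable (τ j)
  indep : iIndepFun τ μ
  law : ∀ j t, μ.real {ω | τ j ω = t} = p t

/-- The `r × m` row-sampling matrix for the row indices `t`: its row `j` is
`e_{t j} / √(r * p (t j))`, a multiple of a standard basis vector. -/
def rowSamplingMatrix {m r : ℕ} (p : Fin m → ℝ) (t : Fin r → Fin m) :
    Matrix (Fin r) (Fin m) ℝ :=
  Matrix.of fun j i => if i = t j then 1 / √((r : ℝ) * p (t j)) else 0

/-- The spectral-norm error `‖S² - S Uᵀ Qᵀ Q U S‖`. -/
def samplingError {m d r : ℕ} (U : Matrix (Fin m) (Fin d) ℝ) (S : Matrix (Fin d) (Fin d) ℝ)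
    (Q : Matrix (Fin r) (Fin m) ℝ) : ℝ :=
  ‖S ^ 2 - S * Uᵀ * Qᵀ * Q * U * S‖

/-- The tail bound that involves the condition number. -/
def sharpTailBound {d : ℕ} (S : Matrix (Fin d) (Fin d) ℝ) (r : ℕ) (β ε : ℝ) : ℝ :=
  2 * d * Real.exp (-(r * ε ^ 2) /
    (2 * (stableRank S / β - condNumber S ^ (-4 : ℤ)
      + ε * (stableRank S / β - condNumber S ^ (-2 : ℤ)) / 3)))

/-- The simplified tail bound. -/
def simpleTailBound {d : ℕ} (S : Matrix (Fin d) (Fin d) ℝ) (r : ℕ) (β ε : ℝ) : ℝ :=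
  2 * d * Real.exp (-(r * β * ε ^ 2) / (4 * stableRank S))

end

/-! ### Trace inequalities for powers of products of symmetric matrices. -/

section TraceInequalities

/-! Put `w_t = S u_t`. Since `Uᵀ U = 1`, the matrices `w_t w_tᵀ` sum to `S²`, so up to sign the
error matrix is the average of `r` i.i.d. copies of the centred matrix `X_t = w_t w_tᵀ / p_t - S²`.
The hypothesis on `p` says `|w_t|² ≤ c p_t` with `c = tr(S²)/β`, hence `w_t w_tᵀ / p_t ≤ c` in the
Loewner order. If `b ≤ S² ≤ s`, then `-s ≤ X_t ≤ c - b` and `∑ p_t X_t² ≤ c S² - S⁴ ≤ c s - b²`.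
These are the inputs of `matrix_bernstein`: `b = 0` leads to `B₂`, and `b = κ⁻²‖S‖²` to `B₁`.

Bernstein follows the Ahlswede–Winter route. The exponential of the norm is bounded by two trace
exponentials, the samples are peeled off one at a time by Golden–Thompson (`trace_exp_add_le`), and
each mean `E exp(θX)` is dominated by a quadratic bound for the exponential. Golden–Thompson itself
combines `tr (PQ)^(2^k) ≤ tr P^(2^k) Q^(2^k)` with the Lie–Trotter formula. -/

theorem trace_mul_transpose_self_nonneg {n : Type*} [Fintype n] (X : Matrix n n ℝ) :
    0 ≤ (X * Xᵀ).trace := by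
  simpa [conjTranspose_eq_transpose_of_trivial] using
    (posSemidef_self_mul_conjTranspose X).trace_nonneg

variable {n : Type*} [Fintype n] [DecidableEq n]

theorem trace_mul_pow_comm (X Y : Matrix n n ℝ) (k : ℕ) :
    ((X * Y) ^ k).trace = ((Y * X) ^ k).trace := by
  cases k with
  | zero => simp
  | succ k => rw [pow_succ, ← mul_assoc, trace_mul_comm, ← mul_assoc, pow_succ',
      ← mul_pow_mul, ← pow_succ', pow_succ, mul_assoc]

/-- Two trace inequalities for powers, proved by a simultaneous induction. -/
theorem trace_pow_two_pow_aux (k : ℕ) :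
    (∀ Z : Matrix n n ℝ, (Z ^ 2 ^ (k + 1)).trace ≤ ((Z * Zᵀ) ^ 2 ^ k).trace) ∧
    (∀ P Q : Matrix n n ℝ, P.IsSymm → Q.IsSymm →
      ((P * Q) ^ 2 ^ k).trace ≤ ((P ^ 2 ^ (k + 1)).trace + (Q ^ 2 ^ (k + 1)).trace) / 2) := by
  induction k with
  | zero =>
    constructor
    · intro Z
      -- Both base cases expand a squared Frobenius norm, here of `Z - Zᵀ` and below of `P - Q`.
      have h := trace_mul_transpose_self_nonneg (Z - Zᵀ)
      have h1 : (Zᵀ * Zᵀ).trace = (Z * Z).trace := by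
        rw [← transpose_mul, trace_transpose]
      have h2 : (Zᵀ * Z).trace = (Z * Zᵀ).trace := trace_mul_comm _ _
      simp only [transpose_sub, transpose_transpose, mul_sub, sub_mul, trace_sub, h1, h2] at h
      simp only [zero_add, pow_one, pow_zero, sq]
      linarith
    · intro P Q hP hQ
      have h := trace_mul_transpose_self_nonneg (P - Q)
      have h2 : (Q * P).trace = (P * Q).trace := trace_mul_comm _ _
      simp only [transpose_sub, hP.eq, hQ.eq, mul_sub, sub_mul, trace_sub, h2] at h
      simp only [zero_add, pow_one, pow_zero, sq]
      linarith
  | succ k ih =>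
    obtain ⟨ihA, ihB⟩ := ih
    have e : ∀ X : Matrix n n ℝ, X ^ 2 ^ (k + 1 + 1) = (X * X) ^ 2 ^ (k + 1) := fun X ↦ by
      rw [← sq, ← pow_mul, ← pow_succ']
    have e' : ∀ X : Matrix n n ℝ, (X * X) ^ 2 ^ k = X ^ 2 ^ (k + 1) := fun X ↦ by
      rw [← sq, ← pow_mul, ← pow_succ']
    constructor
    · intro Z
      -- By cyclicity `Z Z Zᵀ Zᵀ` becomes the product of the symmetric matrices `Zᵀ Z` and `Z Zᵀ`;
      -- the second inequality splits it, and the two resulting traces coincide.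
      have h1 := ihA (Z * Z)
      have h2 : ((Z * Z * (Z * Z)ᵀ) ^ 2 ^ k).trace = ((Zᵀ * Z * (Z * Zᵀ)) ^ 2 ^ k).trace := by
        rw [transpose_mul, ← mul_assoc, trace_mul_pow_comm]
        simp only [mul_assoc]
      have h3 := ihB (Zᵀ * Z) (Z * Zᵀ) (isSymm_transpose_mul_self Z) (isSymm_mul_transpose_self Z)
      have h4 := trace_mul_pow_comm Zᵀ Z (2 ^ (k + 1))
      rw [e]
      linarith
    · intro P Q hP hQ
      have h1 := ihA (P * Q)
      have h2 : ((P * Q * (P * Q)ᵀ) ^ 2 ^ k).trace = ((P * P * (Q * Q)) ^ 2 ^ k).trace := by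
        rw [transpose_mul, hP.eq, hQ.eq, ← mul_assoc, trace_mul_pow_comm]
        simp only [mul_assoc]
      have hs : ∀ X : Matrix n n ℝ, X.IsSymm → (X * X).IsSymm := fun X hX ↦ by
        rw [IsSymm, transpose_mul, hX.eq]
      have h3 := ihB (P * P) (Q * Q) (hs P hP) (hs Q hQ)
      rw [e, e]
      linarith

theorem trace_pow_two_pow_le (Z : Matrix n n ℝ) (k : ℕ) :
    (Z ^ 2 ^ (k + 1)).trace ≤ ((Z * Zᵀ) ^ 2 ^ k).trace :=
  (trace_pow_two_pow_aux k).1 Z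

/-- One application of `trace_pow_two_pow_le` and cyclicity replaces `(PQ)^(2^(k+1))` by
`(P²Q²)^(2^k)`; this is iterated, as squares stay symmetric. -/
theorem trace_mul_pow_two_pow_le (k : ℕ) {P Q : Matrix n n ℝ} (hP : P.IsSymm) (hQ : Q.IsSymm) :
    ((P * Q) ^ 2 ^ k).trace ≤ (P ^ 2 ^ k * Q ^ 2 ^ k).trace := by
  induction k generalizing P Q with
  | zero => simp
  | succ k ih =>
    have h1 := trace_pow_two_pow_le (P * Q) k
    have h2 : ((P * Q * (P * Q)ᵀ) ^ 2 ^ k).trace = ((P ^ 2 * Q ^ 2) ^ 2 ^ k).trace := by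
      rw [transpose_mul, hP.eq, hQ.eq, ← mul_assoc, trace_mul_pow_comm]
      simp only [mul_assoc, sq]
    have h3 := ih (hP.pow 2) (hQ.pow 2)
    rw [← pow_mul, ← pow_mul, ← pow_succ'] at h3
    linarith

end TraceInequalities

/-! ### The Lie–Trotter product formula. -/

section LieTrotter

open Filter Topology

variable {𝔸 : Type*} [NormedRing 𝔸] [NormOneClass 𝔸]

theorem norm_pow_sub_pow_le {X Y : 𝔸} {M : ℝ} (hX : ‖X‖ ≤ M) (hY : ‖Y‖ ≤ M) (hM : 1 ≤ M)
    (k : ℕ) : ‖X ^ k - Y ^ k‖ ≤ k * M ^ k * ‖X - Y‖ := by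
  induction k with
  | zero => simp
  | succ k ih =>
    have e : X ^ (k + 1) - Y ^ (k + 1) = (X ^ k - Y ^ k) * X + Y ^ k * (X - Y) := by
      rw [pow_succ, pow_succ]; noncomm_ring
    have hM0 : 0 ≤ M := zero_le_one.trans hM
    have hYk : ‖Y ^ k‖ ≤ M ^ (k + 1) := (norm_pow_le Y k).trans
      ((pow_le_pow_left₀ (norm_nonneg _) hY k).trans (pow_le_pow_right₀ hM k.le_succ))
    calc ‖X ^ (k + 1) - Y ^ (k + 1)‖ ≤ ‖X ^ k - Y ^ k‖ * ‖X‖ + ‖Y ^ k‖ * ‖X - Y‖ := by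
          rw [e]
          exact (norm_add_le _ _).trans (add_le_add (norm_mul_le _ _) (norm_mul_le _ _))
      _ ≤ k * M ^ k * ‖X - Y‖ * M + M ^ (k + 1) * ‖X - Y‖ := by gcongr
      _ = ↑(k + 1) * M ^ (k + 1) * ‖X - Y‖ := by push_cast; ring

variable [NormedAlgebra ℝ 𝔸]

/-- Two curves through `1` with the same velocity there have asymptotically the same powers
`f (1 / k) ^ k`. -/
theorem tendsto_pow_sub_pow_of_hasDerivAt {f g : ℝ → 𝔸} {C : 𝔸} (hf : HasDerivAt f C 0)
    (hg : HasDerivAt g C 0) (hf0 : f 0 = 1) (hg0 : g 0 = 1) :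
    Tendsto (fun k : ℕ ↦ f (k : ℝ)⁻¹ ^ k - g (k : ℝ)⁻¹ ^ k) atTop (𝓝 0) := by
  have hbound : ∀ h : ℝ → 𝔸, HasDerivAt h C 0 → h 0 = 1 →
      ∀ᶠ x in 𝓝 (0 : ℝ), ‖h x‖ ≤ 1 + (‖C‖ + 1) * |x| := by
    intro h hh h0
    have h1 := (hasDerivAt_iff_isLittleO.1 hh).def one_pos
    filter_upwards [h1] with x hx
    simp only [sub_zero, h0, one_mul, Real.norm_eq_abs] at hx
    calc ‖h x‖ = ‖1 + (h x - 1 - x • C) + x • C‖ := by congr 1; abel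
      _ ≤ ‖(1 : 𝔸)‖ + ‖h x - 1 - x • C‖ + ‖x • C‖ := norm_add₃_le
      _ ≤ 1 + |x| + |x| * ‖C‖ := by
          rw [norm_smul, Real.norm_eq_abs, norm_one]; gcongr
      _ = _ := by ring
  have hlim : Tendsto (fun k : ℕ ↦ (k : ℝ)⁻¹) atTop (𝓝 0) :=
    tendsto_inv_atTop_zero.comp tendsto_natCast_atTop_atTop
  have hfg : (fun x ↦ f x - g x) =o[𝓝 0] fun x : ℝ ↦ x := by
    have := hasDerivAt_iff_isLittleO.1 (hf.sub hg)
    simpa [hf0, hg0] using this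
  rw [Metric.tendsto_nhds]
  intro η hη
  have hK : 0 < Real.exp (‖C‖ + 1) := Real.exp_pos _
  -- Chosen so that the factor `k * exp (‖C‖ + 1)` from the telescoping bound, times the `o(1/k)`
  -- difference, is at most `η / 2`.
  have hc : 0 < η / Real.exp (‖C‖ + 1) / 2 := by positivity
  filter_upwards [hlim.eventually (hbound f hf hf0), hlim.eventually (hbound g hg hg0),
    hlim.eventually (hfg.def hc), eventually_gt_atTop 0] with k h1 h2 h3 hk
  have hk' : (0 : ℝ) < k := by exact_mod_cast hk
  rw [abs_of_pos (by positivity)] at h1 h2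
  rw [Real.norm_eq_abs, abs_of_pos (by positivity)] at h3
  have hM : 1 ≤ 1 + (‖C‖ + 1) * (k : ℝ)⁻¹ := by
    have : 0 ≤ (‖C‖ + 1) * (k : ℝ)⁻¹ := by positivity
    linarith
  have hMk : (1 + (‖C‖ + 1) * (k : ℝ)⁻¹) ^ k ≤ Real.exp (‖C‖ + 1) := by
    have h4 : 1 + (‖C‖ + 1) * (k : ℝ)⁻¹ ≤ Real.exp ((‖C‖ + 1) * (k : ℝ)⁻¹) := by
      linarith [Real.add_one_le_exp ((‖C‖ + 1) * (k : ℝ)⁻¹)]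
    calc _ ≤ Real.exp ((‖C‖ + 1) * (k : ℝ)⁻¹) ^ k := pow_le_pow_left₀ (by linarith) h4 k
      _ = _ := by rw [← Real.exp_nat_mul]; congr 1; field_simp
  rw [dist_zero_right]
  calc _ ≤ k * (1 + (‖C‖ + 1) * (k : ℝ)⁻¹) ^ k * ‖f (k : ℝ)⁻¹ - g (k : ℝ)⁻¹‖ :=
        norm_pow_sub_pow_le h1 h2 hM k
    _ ≤ k * Real.exp (‖C‖ + 1) * (η / Real.exp (‖C‖ + 1) / 2 * (k : ℝ)⁻¹) := by gcongr
    _ = η / 2 := by field_simp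
    _ < η := by linarith

/-- The Lie–Trotter product formula. -/
theorem tendsto_exp_smul_mul_exp_smul_pow [CompleteSpace 𝔸] (A B : 𝔸) :
    Tendsto (fun k : ℕ ↦ (NormedSpace.exp ((k : ℝ)⁻¹ • A) * NormedSpace.exp ((k : ℝ)⁻¹ • B)) ^ k)
      atTop (𝓝 (NormedSpace.exp (A + B))) := by
  let : NormedAlgebra ℚ 𝔸 := NormedAlgebra.restrictScalars ℚ ℝ 𝔸
  have hA := hasDerivAt_exp_smul_const (𝕂 := ℝ) A 0
  have hB := hasDerivAt_exp_smul_const (𝕂 := ℝ) B 0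
  have hAB := hasDerivAt_exp_smul_const (𝕂 := ℝ) (A + B) 0
  have h := tendsto_pow_sub_pow_of_hasDerivAt (C := A + B)
    (f := fun x : ℝ ↦ NormedSpace.exp (x • A) * NormedSpace.exp (x • B))
    (g := fun x : ℝ ↦ NormedSpace.exp (x • (A + B)))
    (by simpa [Pi.mul_def] using hA.mul hB) (by simpa using hAB) (by simp) (by simp)
  have h2 := h.add_const (NormedSpace.exp (A + B))
  rw [zero_add] at h2
  refine h2.congr' ?_
  filter_upwards [eventually_gt_atTop 0] with k hk
  have hk' : (k : ℝ) ≠ 0 := by exact_mod_cast hk.ne'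
  have e : NormedSpace.exp ((k : ℝ)⁻¹ • (A + B)) ^ k = NormedSpace.exp (A + B) := by
    rw [← NormedSpace.exp_nsmul, ← Nat.cast_smul_eq_nsmul ℝ, smul_smul, mul_inv_cancel₀ hk',
      one_smul]
  simp only [e, sub_add_cancel]

end LieTrotter

/-! ### The Golden–Thompson inequality. -/

section GoldenThompson

open Filter Topology

variable {n : Type*} [Fintype n] [DecidableEq n]

/-- The Golden–Thompson inequality. -/
theorem trace_exp_add_le {A B : Matrix n n ℝ} (hA : A.IsSymm) (hB : B.IsSymm) :
    (NormedSpace.exp (A + B)).trace ≤ (NormedSpace.exp A * NormedSpace.exp B).trace := by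
  cases isEmpty_or_nonempty n with
  | inl h => simp [trace]
  | inr h =>
  have hcont : Continuous (trace : Matrix n n ℝ → ℝ) := continuous_id.matrix_trace
  -- The trace inequality is available for exponents `2 ^ j` only, so Lie–Trotter is used along this
  -- subsequence.
  have hpow : Tendsto (fun j : ℕ ↦ 2 ^ j) atTop atTop :=
    tendsto_pow_atTop_atTop_of_one_lt one_lt_two
  have hlim := (hcont.tendsto _).comp
    ((tendsto_exp_smul_mul_exp_smul_pow A B).comp hpow)
  refine le_of_tendsto hlim (Eventually.of_forall fun j ↦ ?_)
  have e : ∀ X : Matrix n n ℝ,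
      NormedSpace.exp (((2 ^ j : ℕ) : ℝ)⁻¹ • X) ^ 2 ^ j = NormedSpace.exp X := fun X ↦ by
    rw [← Matrix.exp_nsmul, ← Nat.cast_smul_eq_nsmul ℝ, smul_smul, mul_inv_cancel₀ (by positivity),
      one_smul]
  have h := trace_mul_pow_two_pow_le j (hA.smul (((2 ^ j : ℕ) : ℝ)⁻¹)).exp
    (hB.smul (((2 ^ j : ℕ) : ℝ)⁻¹)).exp
  rw [e, e] at h
  exact h

end GoldenThompson

/-- Bernstein's quadratic bound for the exponential on `[-R, R]`, `R < 3`. -/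
theorem exp_le_bernstein {x R : ℝ} (hx : |x| ≤ R) (hR : R < 3) :
    Real.exp x ≤ 1 + x + (2 * (1 - R / 3))⁻¹ * x ^ 2 := by
  have hx3 : |x| / 3 < 1 := by linarith
  have h1 : HasSum (fun k : ℕ ↦ x ^ (k + 2) / (k + 2).factorial) (Real.exp x - (1 + x)) := by
    have h := (hasSum_nat_add_iff' 2).2 (NormedSpace.expSeries_div_hasSum_exp x)
    simpa [Finset.sum_range_succ, Real.exp_eq_exp_ℝ] using h
  have h2 : HasSum (fun k : ℕ ↦ x ^ 2 / 2 * (|x| / 3) ^ k) (x ^ 2 / 2 * (1 - |x| / 3)⁻¹) :=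
    (hasSum_geometric_of_lt_one (by positivity) hx3).mul_left _
  -- This makes the exponential tail at most a geometric series of ratio `|x| / 3`.
  have hfac : ∀ k : ℕ, 2 * 3 ^ k ≤ (k + 2).factorial := by
    intro k
    induction k with
    | zero => simp
    | succ k ih =>
      rw [show k + 1 + 2 = (k + 2) + 1 by ring, Nat.factorial_succ, pow_succ]
      nlinarith
  have h3 := hasSum_le (fun k ↦ ?_) h1 h2
  · have h4 : (1 - |x| / 3)⁻¹ ≤ (1 - R / 3)⁻¹ := inv_anti₀ (by linarith) (by linarith)
    have h5 := mul_le_mul_of_nonneg_left h4 (show 0 ≤ x ^ 2 / 2 by positivity)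
    rw [mul_inv]
    linarith
  · have hk : (2 * 3 ^ k : ℝ) ≤ (k + 2).factorial := by exact_mod_cast hfac k
    calc x ^ (k + 2) / ((k + 2).factorial : ℝ) ≤ |x| ^ (k + 2) / (k + 2).factorial := by
          rw [← abs_pow]
          exact div_le_div_of_nonneg_right (le_abs_self _) (by positivity)
      _ ≤ |x| ^ (k + 2) / (2 * 3 ^ k) := by gcongr
      _ = x ^ 2 / 2 * (|x| / 3) ^ k := by
          rw [pow_add, sq_abs, div_pow]
          field_simp

/-! ### The matrix Bernstein inequality. -/

section MatrixBernstein

theorem isSymm_sum {n ι : Type*} (s : Finset ι) {X : ι → Matrix n n ℝ} (hX : ∀ t, (X t).IsSymm) :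
    (∑ t ∈ s, X t).IsSymm := by
  rw [IsSymm, transpose_sum]
  exact Finset.sum_congr rfl fun t _ ↦ hX t

variable {n : Type*} [Fintype n] [DecidableEq n]

theorem exists_orthogonal_diagonalization {A : Matrix n n ℝ} (hA : A.IsSymm) :
    ∃ (V : Matrix n n ℝ) (l : n → ℝ), Vᵀ * V = 1 ∧ V * Vᵀ = 1 ∧ A = V * diagonal l * Vᵀ := by
  have hA' : A.IsHermitian := by rwa [IsHermitian, conjTranspose_eq_transpose_of_trivial]
  refine ⟨hA'.eigenvectorUnitary, hA'.eigenvalues, ?_, ?_, ?_⟩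
  · simpa [star_eq_conjTranspose, conjTranspose_eq_transpose_of_trivial] using
      Unitary.coe_star_mul_self hA'.eigenvectorUnitary
  · simpa [star_eq_conjTranspose, conjTranspose_eq_transpose_of_trivial] using
      Unitary.coe_mul_star_self hA'.eigenvectorUnitary
  · conv_lhs => rw [hA'.spectral_theorem]
    simp [Unitary.conjStarAlgAut_apply, star_eq_conjTranspose,
      conjTranspose_eq_transpose_of_trivial]

theorem exp_orthogonal_conj {V : Matrix n n ℝ} (h1 : Vᵀ * V = 1) (l : n → ℝ) :
    NormedSpace.exp (V * diagonal l * Vᵀ) = V * diagonal (fun i ↦ Real.exp (l i)) * Vᵀ := by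
  have hV : V⁻¹ = Vᵀ := inv_eq_left_inv h1
  have hU : IsUnit V := IsUnit.of_mul_eq_one_right _ h1
  rw [← hV, Matrix.exp_conj V _ hU, Matrix.exp_diagonal]
  congr 3
  ext i
  rw [Pi.coe_exp, Real.exp_eq_exp_ℝ]

theorem trace_orthogonal_conj {V : Matrix n n ℝ} (h1 : Vᵀ * V = 1) (l : n → ℝ) :
    (V * diagonal l * Vᵀ).trace = ∑ i, l i := by
  rw [trace_mul_comm, ← mul_assoc, h1, one_mul, trace_diagonal]

theorem norm_orthogonal_conj_le {V : Matrix n n ℝ} (h1 : Vᵀ * V = 1) (l : n → ℝ) :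
    ‖V * diagonal l * Vᵀ‖ ≤ ‖l‖ := by
  cases isEmpty_or_nonempty n with
  | inl h => simp [Subsingleton.elim (V * diagonal l * Vᵀ) 0]
  | inr h =>
  have hV : ‖V‖ = 1 := by
    have := l2_opNorm_conjTranspose_mul_self V
    rw [conjTranspose_eq_transpose_of_trivial, h1, norm_one] at this
    nlinarith [norm_nonneg V]
  have hVt : ‖Vᵀ‖ = 1 := by
    rw [← conjTranspose_eq_transpose_of_trivial, l2_opNorm_conjTranspose, hV]
  have := (l2_opNorm_mul (V * diagonal l) Vᵀ).trans
    (mul_le_mul_of_nonneg_right (l2_opNorm_mul V (diagonal l)) (norm_nonneg _))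
  rwa [hV, hVt, l2_opNorm_diagonal, one_mul, mul_one] at this

/-- The norm is at most some `|l i|` with `l i` an eigenvalue, and the exponential of that number is
at most the `i`-th summand of the two traces, all of whose summands are positive. Using both signs
costs the factor 2 in the tail bounds. -/
theorem exp_norm_le_trace_exp_add [Nonempty n] {A : Matrix n n ℝ} (hA : A.IsSymm) :
    Real.exp ‖A‖ ≤ (NormedSpace.exp A).trace + (NormedSpace.exp (-A)).trace := by
  obtain ⟨V, l, h1, -, rfl⟩ := exists_orthogonal_diagonalization hA
  have hneg : -(V * diagonal l * Vᵀ) = V * diagonal (fun i ↦ -l i) * Vᵀ := by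
    rw [show (diagonal fun i ↦ -l i) = -diagonal l from (diagonal_neg l).symm, mul_neg, neg_mul]
  rw [hneg, exp_orthogonal_conj h1, exp_orthogonal_conj h1, trace_orthogonal_conj h1,
    trace_orthogonal_conj h1, ← Finset.sum_add_distrib]
  obtain ⟨i, hi⟩ : ∃ i, ‖l‖ ≤ |l i| := by
    obtain ⟨i, -, hi⟩ := Finset.exists_max_image Finset.univ (fun i ↦ |l i|)
      Finset.univ_nonempty
    exact ⟨i, (pi_norm_le_iff_of_nonneg (abs_nonneg _)).2 fun j ↦ hi j (Finset.mem_univ _)⟩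
  calc _ ≤ Real.exp |l i| := Real.exp_le_exp.2 ((norm_orthogonal_conj_le h1 l).trans hi)
    _ ≤ Real.exp (l i) + Real.exp (-l i) := Real.exp_abs_le _
    _ ≤ _ := Finset.single_le_sum
        (f := fun i ↦ Real.exp (l i) + Real.exp (-l i)) (fun j _ ↦ by positivity)
        (Finset.mem_univ i)

theorem posSemidef_orthogonal_conj_iff {V : Matrix n n ℝ} (h1 : Vᵀ * V = 1) (l : n → ℝ) :
    (V * diagonal l * Vᵀ).PosSemidef ↔ ∀ i, 0 ≤ l i := by
  have hU : IsUnit V := IsUnit.of_mul_eq_one_right _ h1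
  have := IsUnit.posSemidef_star_right_conjugate_iff (x := diagonal l) hU
  rw [star_eq_conjTranspose, conjTranspose_eq_transpose_of_trivial] at this
  rw [this, posSemidef_diagonal_iff]

/-- Every matrix involved is diagonal in an eigenbasis of `X`, so this is `exp_le_bernstein` at each
eigenvalue. -/
theorem posSemidef_bernstein_sub_exp {X : Matrix n n ℝ} {R : ℝ} (hX : X.IsSymm)
    (h1 : (R • 1 - X).PosSemidef) (h2 : (R • 1 + X).PosSemidef) (hR : R < 3) :
    (1 + X + (2 * (1 - R / 3))⁻¹ • X ^ 2 - NormedSpace.exp X).PosSemidef := by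
  obtain ⟨V, l, hV, hV', rfl⟩ := exists_orthogonal_diagonalization hX
  have hc : ∀ c : ℝ, c • (1 : Matrix n n ℝ) = V * diagonal (fun _ ↦ c) * Vᵀ := fun c ↦ by
    rw [← smul_one_eq_diagonal]
    simp [hV']
  have hsq : (V * diagonal l * Vᵀ) ^ 2 = V * diagonal (fun i ↦ l i ^ 2) * Vᵀ := by
    calc _ = V * diagonal l * (Vᵀ * V) * diagonal l * Vᵀ := by simp only [sq, mul_assoc]
      _ = _ := by
        rw [hV, mul_one, mul_assoc V, diagonal_mul_diagonal]
        simp only [sq]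
  rw [hc, ← sub_mul, ← mul_sub, diagonal_sub, posSemidef_orthogonal_conj_iff hV] at h1
  rw [hc, ← add_mul, ← mul_add, diagonal_add, posSemidef_orthogonal_conj_iff hV] at h2
  have hone := hc 1
  rw [one_smul] at hone
  rw [hsq, exp_orthogonal_conj hV]
  conv => arg 1; arg 1; arg 1; arg 1; rw [hone]
  rw [← smul_mul_assoc, ← mul_smul_comm, ← diagonal_smul, ← add_mul, ← mul_add, diagonal_add,
    ← add_mul, ← mul_add, diagonal_add, ← sub_mul, ← mul_sub, diagonal_sub,
    posSemidef_orthogonal_conj_iff hV]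
  intro i
  have := exp_le_bernstein (x := l i) (abs_le.2 ⟨by linarith [h2 i], by linarith [h1 i]⟩) hR
  simpa using this

theorem Matrix.PosSemidef.trace_mul_nonneg {P Q : Matrix n n ℝ} (hP : P.PosSemidef)
    (hQ : Q.PosSemidef) : 0 ≤ (P * Q).trace := by
  open scoped MatrixOrder in
  obtain ⟨a, rfl⟩ := CStarAlgebra.nonneg_iff_eq_star_mul_self.mp hP.nonneg
  rw [star_eq_conjTranspose, mul_assoc, trace_mul_comm]
  exact (hQ.mul_mul_conjTranspose_same a).trace_nonneg

theorem trace_mul_le_of_posSemidef {P Q : Matrix n n ℝ} {c : ℝ} (hP : P.PosSemidef)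
    (hQ : (c • 1 - Q).PosSemidef) : (P * Q).trace ≤ c * P.trace := by
  have := hP.trace_mul_nonneg hQ
  simp only [mul_sub, mul_smul_comm, mul_one, trace_sub, trace_smul, smul_eq_mul] at this
  linarith

theorem posSemidef_exp {A : Matrix n n ℝ} (hA : A.IsSymm) :
    (NormedSpace.exp A).PosSemidef := by
  obtain ⟨V, l, h1, -, rfl⟩ := exists_orthogonal_diagonalization hA
  rw [exp_orthogonal_conj h1, posSemidef_orthogonal_conj_iff h1]
  intro i
  positivity

variable {ι : Type*} [Fintype ι]

/-- The Ahlswede–Winter bound on the trace of the exponential of a sum of i.i.d. matrices. -/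
theorem sum_prod_mul_trace_exp_le {p : ι → ℝ} (hp : ∀ t, 0 ≤ p t) {Y : ι → Matrix n n ℝ}
    (hY : ∀ t, (Y t).IsSymm) {c : ℝ} (hc0 : 0 ≤ c)
    (hc : (c • 1 - ∑ t, p t • NormedSpace.exp (Y t)).PosSemidef) (r : ℕ)
    {H : Matrix n n ℝ} (hH : H.IsSymm) :
    ∑ t : Fin r → ι, (∏ j, p (t j)) * (NormedSpace.exp (H + ∑ j, Y (t j))).trace
      ≤ c ^ r * (NormedSpace.exp H).trace := by
  induction r generalizing H with
  | zero => simp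
  | succ r ih =>
    rw [← (Fin.consEquiv fun _ ↦ ι).sum_comp, Fintype.sum_prod_type]
    simp only [Fin.consEquiv_apply, Fin.prod_univ_succ, Fin.sum_univ_succ, Fin.cons_zero,
      Fin.cons_succ]
    calc _ = ∑ s, p s * ∑ t : Fin r → ι, (∏ j, p (t j)) *
          (NormedSpace.exp (H + Y s + ∑ j, Y (t j))).trace := by
          refine Finset.sum_congr rfl fun s _ ↦ ?_
          rw [Finset.mul_sum]
          exact Finset.sum_congr rfl fun t _ ↦ by rw [add_assoc, mul_assoc]
      _ ≤ ∑ s, p s * (c ^ r * (NormedSpace.exp H * NormedSpace.exp (Y s)).trace) := by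
          -- The first sample is absorbed into `H`, which is why the induction generalizes `H`;
          -- Golden–Thompson then separates it again.
          refine Finset.sum_le_sum fun s _ ↦ mul_le_mul_of_nonneg_left ?_ (hp s)
          exact (ih (hH.add (hY s))).trans
            (mul_le_mul_of_nonneg_left (trace_exp_add_le hH (hY s)) (pow_nonneg hc0 r))
      _ = c ^ r * (NormedSpace.exp H * ∑ s, p s • NormedSpace.exp (Y s)).trace := by
          rw [Finset.mul_sum, trace_sum, Finset.mul_sum]
          refine Finset.sum_congr rfl fun s _ ↦ ?_
          rw [mul_smul_comm, trace_smul, smul_eq_mul]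
          ring
      _ ≤ c ^ r * (c * (NormedSpace.exp H).trace) :=
          mul_le_mul_of_nonneg_left (trace_mul_le_of_posSemidef (posSemidef_exp hH) hc)
            (pow_nonneg hc0 r)
      _ = _ := by ring

theorem sum_prod_mul_trace_exp_smul_le {p : ι → ℝ} (hp : ∀ t, 0 ≤ p t) (hp1 : ∑ t, p t = 1)
    {X : ι → Matrix n n ℝ} (hX : ∀ t, (X t).IsSymm) (hmean : ∑ t, p t • X t = 0) {R v θ : ℝ}
    (hR1 : ∀ t, (R • 1 - X t).PosSemidef) (hR2 : ∀ t, (R • 1 + X t).PosSemidef)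
    (hv : (v • 1 - ∑ t, p t • X t ^ 2).PosSemidef) (hθ : 0 ≤ θ) (hθR : θ * R < 3) (r : ℕ) :
    ∑ t : Fin r → ι, (∏ j, p (t j)) * (NormedSpace.exp (θ • ∑ j, X (t j))).trace
      ≤ Fintype.card n * Real.exp (r * ((2 * (1 - θ * R / 3))⁻¹ * θ ^ 2 * v)) := by
  set g := (2 * (1 - θ * R / 3))⁻¹ with hg
  have hg0 : 0 ≤ g := inv_nonneg.2 (by linarith)
  set c := Real.exp (g * θ ^ 2 * v) with hc
  have hY : ∀ t, (θ • X t).IsSymm := fun t ↦ (hX t).smul θ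
  have hB : ∀ t, (1 + θ • X t + g • (θ • X t) ^ 2 - NormedSpace.exp (θ • X t)).PosSemidef := by
    intro t
    refine posSemidef_bernstein_sub_exp (hY t) ?_ ?_ hθR
    · simpa [smul_sub, smul_smul] using (hR1 t).smul hθ
    · simpa [smul_add, smul_smul] using (hR2 t).smul hθ
  -- The mean is at most `1 + gθ² ∑ p X² ≤ 1 + gθ²v ≤ c`, the linear term vanishing by centring. The
  -- three positive semidefinite pieces are the gaps in this chain.
  have hpsd : (c • 1 - ∑ t, p t • NormedSpace.exp (θ • X t)).PosSemidef := by
    have h1 : ((c - (1 + g * θ ^ 2 * v)) • (1 : Matrix n n ℝ)).PosSemidef :=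
      PosSemidef.one.smul (by linarith [Real.add_one_le_exp (g * θ ^ 2 * v)])
    have h2 := hv.smul (show 0 ≤ g * θ ^ 2 by positivity)
    have h3 := posSemidef_sum Finset.univ fun t _ ↦ (hB t).smul (hp t)
    convert (h1.add h2).add h3 using 1
    have e : ∑ t, p t • (1 + θ • X t + g • (θ • X t) ^ 2 - NormedSpace.exp (θ • X t))
        = 1 + (g * θ ^ 2) • ∑ t, p t • X t ^ 2 - ∑ t, p t • NormedSpace.exp (θ • X t) := by
      have e1 : ∑ t, p t • θ • X t = 0 := by
        simp_rw [smul_comm _ θ]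
        rw [← Finset.smul_sum, hmean, smul_zero]
      have e2 : ∑ t, p t • g • (θ • X t) ^ 2 = (g * θ ^ 2) • ∑ t, p t • X t ^ 2 := by
        rw [Finset.smul_sum]
        refine Finset.sum_congr rfl fun t _ ↦ ?_
        rw [smul_pow, smul_smul, smul_smul, smul_smul]
        congr 1
        ring
      simp only [smul_sub, smul_add, Finset.sum_sub_distrib, Finset.sum_add_distrib, e1, e2,
        ← Finset.sum_smul, hp1, one_smul, add_zero]
    rw [e]
    module
  have h := sum_prod_mul_trace_exp_le hp hY (Real.exp_pos _).le hpsd r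
    (H := 0) isSymm_zero
  simp only [zero_add, NormedSpace.exp_zero, trace_one, ← Finset.smul_sum] at h
  rw [Real.exp_nat_mul, mul_comm (Fintype.card n : ℝ)]
  exact h

/-- The matrix Bernstein inequality for a sum of i.i.d. symmetric matrices with finitely many
values: the left side is the probability that the norm of the sum exceeds `r * ε`. -/
theorem matrix_bernstein {p : ι → ℝ} (hp : ∀ t, 0 ≤ p t) (hp1 : ∑ t, p t = 1)
    {X : ι → Matrix n n ℝ} (hX : ∀ t, (X t).IsSymm) (hmean : ∑ t, p t • X t = 0) {R v ε : ℝ}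
    (hR1 : ∀ t, (R • 1 - X t).PosSemidef) (hR2 : ∀ t, (R • 1 + X t).PosSemidef)
    (hv : (v • 1 - ∑ t, p t • X t ^ 2).PosSemidef) (hR0 : 0 ≤ R) (hv0 : 0 < v) (hε : 0 < ε)
    (r : ℕ) :
    ∑ t : Fin r → ι with r * ε < ‖∑ j, X (t j)‖, ∏ j, p (t j)
      ≤ 2 * Fintype.card n * Real.exp (-(r * ε ^ 2) / (2 * (v + ε * R / 3))) := by
  cases isEmpty_or_nonempty n with
  | inl h =>
    rw [Finset.sum_eq_zero]
    · simp
    · intro t ht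
      rw [Finset.mem_filter, Subsingleton.elim (∑ j, X (t j)) 0, norm_zero] at ht
      exact absurd ht.2 (not_lt.2 (by positivity))
  | inr h =>
  have hD : 0 < v + ε * R / 3 := by positivity
  set D := v + ε * R / 3 with hDdef
  -- Bernstein's parameter: it gives `1 - θR/3 = v/D`, so the total exponent is `-rε²/D + rε²/(2D) =
  -- -rε²/(2D)`. Positivity of `v` yields `θR < 3`.
  set θ := ε / D with hθ
  have hθ0 : 0 ≤ θ := by positivity
  have hθR : θ * R < 3 := by
    rw [hθ, div_mul_eq_mul_div, div_lt_iff₀ hD]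
    linarith
  have hgv : (2 * (1 - θ * R / 3))⁻¹ * θ ^ 2 * v = ε ^ 2 / (2 * D) := by
    have : 1 - θ * R / 3 = v / D := by
      rw [hθ]
      field_simp
      rw [hDdef]
      ring
    rw [this, hθ]
    field_simp
  have hprod : ∀ t : Fin r → ι, 0 ≤ ∏ j, p (t j) := fun t ↦ Finset.prod_nonneg fun j _ ↦ hp _
  have hpos := sum_prod_mul_trace_exp_smul_le hp hp1 hX hmean hR1 hR2 hv hθ0 hθR r
  have hneg := sum_prod_mul_trace_exp_smul_le hp hp1 (X := fun t ↦ -X t) (fun t ↦ (hX t).neg)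
    (by simp [hmean]) (fun t ↦ by simpa using hR2 t)
    (fun t ↦ by simpa [sub_eq_add_neg] using hR1 t) (by simpa using hv) hθ0 hθR r
  rw [hgv] at hpos hneg
  calc _ ≤ ∑ t : Fin r → ι, Real.exp (-(θ * (r * ε))) * ((∏ j, p (t j)) *
        (NormedSpace.exp (θ • ∑ j, X (t j))).trace
        + (∏ j, p (t j)) * (NormedSpace.exp (θ • ∑ j, -X (t j))).trace) := by
        have hterm : ∀ t : Fin r → ι, Real.exp ‖θ • ∑ j, X (t j)‖ ≤
            (NormedSpace.exp (θ • ∑ j, X (t j))).trace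
              + (NormedSpace.exp (θ • ∑ j, -X (t j))).trace := fun t ↦ by
          have := exp_norm_le_trace_exp_add ((isSymm_sum Finset.univ fun j ↦ hX (t j)).smul θ)
          simpa [Finset.sum_neg_distrib] using this
        rw [Finset.sum_filter]
        refine Finset.sum_le_sum fun t _ ↦ ?_
        rw [← mul_add]
        have ht := hterm t
        split_ifs with hif
        · have h1 : Real.exp (θ * (r * ε)) ≤ Real.exp ‖θ • ∑ j, X (t j)‖ := by
            rw [norm_smul, Real.norm_of_nonneg hθ0]
            gcongr
          calc ∏ j, p (t j) = Real.exp (-(θ * (r * ε))) *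
                ((∏ j, p (t j)) * Real.exp (θ * (r * ε))) := by
                rw [mul_left_comm, ← Real.exp_add]; simp
            _ ≤ _ := by
                gcongr
                · exact hprod t
                · exact h1.trans ht
        · exact mul_nonneg (Real.exp_pos _).le
            (mul_nonneg (hprod t) ((Real.exp_pos _).le.trans ht))
    _ ≤ Real.exp (-(θ * (r * ε))) * (Fintype.card n * Real.exp (r * (ε ^ 2 / (2 * D)))
        + Fintype.card n * Real.exp (r * (ε ^ 2 / (2 * D)))) := by
        rw [← Finset.mul_sum, Finset.sum_add_distrib]
        gcongr
    _ = 2 * Fintype.card n *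
        (Real.exp (-(θ * (r * ε))) * Real.exp (r * (ε ^ 2 / (2 * D)))) := by ring
    _ = _ := by
        rw [← Real.exp_add]
        congr 2
        rw [hθ]
        field_simp
        ring

end MatrixBernstein

/-! ### The law of a finite i.i.d. sample. -/

open Classical in
theorem IsIIDSample.measureReal_setOf {Ω : Type*} [MeasurableSpace Ω] {μ : Measure Ω}
    [IsProbabilityMeasure μ] {m r : ℕ} {p : Fin m → ℝ} {τ : Fin r → Ω → Fin m}
    (hτ : IsIIDSample μ p τ) (P : (Fin r → Fin m) → Prop) :
    μ.real {ω | P fun j ↦ τ j ω} = ∑ t : Fin r → Fin m with P t, ∏ j, p (t j) := by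
  have hset : {ω | P fun j ↦ τ j ω} =
      ⋃ t ∈ Finset.univ.filter P, ⋂ j ∈ Finset.univ, τ j ⁻¹' {t j} := by
    ext ω
    simp only [Set.mem_ofPred_eq, Finset.mem_filter, Finset.mem_univ, true_and, Set.iInter_true,
      Set.mem_iUnion, Set.mem_iInter, Set.mem_preimage, Set.mem_singleton_iff, exists_prop]
    constructor
    · exact fun h ↦ ⟨_, h, fun _ ↦ rfl⟩
    · rintro ⟨t, ht, h⟩
      rwa [funext h]
  have hmeas : ∀ t : Fin r → Fin m, MeasurableSet (⋂ j ∈ Finset.univ, τ j ⁻¹' {t j}) := fun t ↦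
    Finset.measurableSet_biInter _ fun j _ ↦ hτ.measurable j (measurableSet_singleton _)
  rw [hset, measureReal_biUnion_finset _ fun t _ ↦ hmeas t]
  · refine Finset.sum_congr rfl fun t _ ↦ ?_
    rw [measureReal_def, hτ.indep.measure_inter_preimage_eq_mul Finset.univ
      fun j _ ↦ measurableSet_singleton _, ENNReal.toReal_prod]
    exact Finset.prod_congr rfl fun j _ ↦ hτ.law j (t j)
  · intro t _ t' _ htt'
    refine Set.disjoint_left.2 fun ω h h' ↦ htt' (funext fun j ↦ ?_)
    simp only [Set.mem_iInter, Set.mem_preimage, Set.mem_singleton_iff, Finset.mem_univ,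
      true_imp_iff] at h h'
    rw [← h j, h' j]

theorem IsIIDSample.measureReal_setOf_add_compl {Ω : Type*} [MeasurableSpace Ω] {μ : Measure Ω}
    [IsProbabilityMeasure μ] {m r : ℕ} {p : Fin m → ℝ} {τ : Fin r → Ω → Fin m}
    (hτ : IsIIDSample μ p τ) (P : (Fin r → Fin m) → Prop) :
    μ.real {ω | P fun j ↦ τ j ω} + μ.real {ω | ¬ P fun j ↦ τ j ω} = 1 := by
  have hm : MeasurableSet {ω | P fun j ↦ τ j ω} :=
    measurable_pi_lambda (fun ω j ↦ τ j ω) hτ.measurable (Set.toFinite {t | P t}).measurableSet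
  rw [← probReal_univ (μ := μ), ← measureReal_add_measureReal_compl hm]
  rfl

/-! ### Singular values, norm and stable rank of a diagonal matrix. -/

section Spectral

variable {d : ℕ}

/-- The `i`-th standard basis vector is an eigenvector of `T* T` with eigenvalue `a i ^ 2`. This
locates each entry between the extreme singular values, without sorting the diagonal. -/
theorem exists_singularValues_diagonal_eq {a : Fin d → ℝ} (i : Fin d) :
    ∃ j < d, (toEuclideanLin (diagonal a)).singularValues j ^ 2 = a i ^ 2 := by
  set T := toEuclideanLin (diagonal a) with hT
  have hfin : Module.finrank ℝ (EuclideanSpace ℝ (Fin d)) = d := finrank_euclideanSpace_fin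
  have hev : Module.End.HasEigenvalue (T.adjoint ∘ₗ T) (a i ^ 2) := by
    refine Module.End.hasEigenvalue_of_hasEigenvector (x := EuclideanSpace.single i (1 : ℝ)) ?_
    rw [Module.End.hasEigenvector_iff, Module.End.mem_eigenspace_iff]
    constructor
    · rw [hT, ← toEuclideanLin_conjTranspose_eq_adjoint, LinearMap.comp_apply]
      ext j
      by_cases hj : j = i
      · subst hj
        simp [toLpLin_apply, sq]
      · simp [toLpLin_apply, hj]
    · simp
  obtain ⟨j, hj⟩ := T.isSymmetric_adjoint_comp_self.exists_eigenvalues_eq hfin hev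
  exact ⟨j, j.2, by rw [T.sq_singularValues_fin hfin j]; exact hj⟩

theorem condNumber_zpow_neg_two_mul_le {a : Fin d → ℝ} (ha : ∀ i, 0 < a i) (i k : Fin d) :
    condNumber (diagonal a) ^ (-2 : ℤ) * a k ^ 2 ≤ a i ^ 2 := by
  set T := toEuclideanLin (diagonal a) with hT
  obtain ⟨j, hj, hji⟩ := exists_singularValues_diagonal_eq (a := a) i
  obtain ⟨l, -, hlk⟩ := exists_singularValues_diagonal_eq (a := a) k
  have h1 : T.singularValues (d - 1) ^ 2 ≤ a i ^ 2 := by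
    rw [← hji]
    exact pow_le_pow_left₀ (T.singularValues_nonneg _)
      (T.singularValues_antitone (Nat.le_sub_one_of_lt hj)) 2
  have h2 : a k ^ 2 ≤ T.singularValues 0 ^ 2 := by
    rw [← hlk]
    exact pow_le_pow_left₀ (T.singularValues_nonneg _) (T.singularValues_antitone l.zero_le) 2
  have h0 : 0 < T.singularValues 0 ^ 2 := (pow_pos (ha k) 2).trans_le h2
  have e : condNumber (diagonal a) ^ (-2 : ℤ) =
      T.singularValues (d - 1) ^ 2 / T.singularValues 0 ^ 2 := by
    rw [condNumber, _root_.zpow_neg, ← hT, div_zpow, inv_div]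
    rfl
  rw [e, div_mul_eq_mul_div, div_le_iff₀ h0]
  exact mul_le_mul h1 h2 (sq_nonneg _) (sq_nonneg _)

theorem abs_le_norm_diagonal (a : Fin d → ℝ) (i : Fin d) : |a i| ≤ ‖diagonal a‖ := by
  rw [l2_opNorm_diagonal]
  exact norm_le_pi_norm a i

theorem exists_norm_diagonal_eq (hd : 1 ≤ d) (a : Fin d → ℝ) : ∃ i, ‖diagonal a‖ = |a i| := by
  have : Nonempty (Fin d) := ⟨⟨0, hd⟩⟩
  rw [l2_opNorm_diagonal]
  obtain ⟨i, -, hi⟩ := Finset.exists_max_image Finset.univ (fun i ↦ |a i|) Finset.univ_nonempty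
  exact ⟨i, le_antisymm ((pi_norm_le_iff_of_nonneg (abs_nonneg _)).2 fun j ↦
    hi j (Finset.mem_univ _)) (norm_le_pi_norm a i)⟩

theorem stableRank_diagonal (a : Fin d → ℝ) :
    stableRank (diagonal a) = (∑ i, a i ^ 2) / ‖diagonal a‖ ^ 2 := by
  rw [stableRank, frobeniusNormSq]
  congr 1
  refine Finset.sum_congr rfl fun i _ ↦ ?_
  rw [Finset.sum_eq_single i (fun j _ hj ↦ by simp [hj.symm]) (by simp), diagonal_apply_eq]

end Spectral

/-! ### Row sampling as a sum of i.i.d. centred rank-one matrices. -/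

section Sampling

theorem posSemidef_smul_one_sub_vecMulVec {n : Type*} [Fintype n] [DecidableEq n] {w : n → ℝ}
    {c : ℝ} (hc : w ⬝ᵥ w ≤ c) : (c • 1 - vecMulVec w w).PosSemidef := by
  refine PosSemidef.of_dotProduct_mulVec_nonneg ?_ fun x ↦ ?_
  · rw [IsHermitian, conjTranspose_eq_transpose_of_trivial]
    simp [transpose_vecMulVec]
  · have hcs : (w ⬝ᵥ x) ^ 2 ≤ (w ⬝ᵥ w) * (x ⬝ᵥ x) := by
      simpa [dotProduct, sq] using Finset.sum_mul_sq_le_sq_mul_sq Finset.univ w x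
    have hx : 0 ≤ x ⬝ᵥ x := Finset.sum_nonneg fun i _ ↦ mul_self_nonneg _
    have e : star x ⬝ᵥ ((c • 1 - vecMulVec w w) *ᵥ x) = c * (x ⬝ᵥ x) - (w ⬝ᵥ x) ^ 2 := by
      rw [sub_mulVec, vecMulVec_mulVec, dotProduct_sub, smul_mulVec, one_mulVec, dotProduct_smul]
      simp [dotProduct_comm x w, sq]
    rw [e]
    nlinarith

variable {m d : ℕ}

theorem sum_vecMulVec_scaled_rows {U : Matrix (Fin m) (Fin d) ℝ} (hU : Uᵀ * U = 1)
    (a : Fin d → ℝ) :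
    ∑ t, vecMulVec (fun i ↦ U t i * a i) (fun i ↦ U t i * a i) = diagonal a ^ 2 := by
  ext i k
  have h := congrFun (congrFun hU i) k
  rw [mul_apply] at h
  simp only [transpose_apply] at h
  rw [Matrix.sum_apply, diagonal_pow]
  simp only [vecMulVec_apply]
  calc _ = (∑ t, U t i * U t k) * (a i * a k) := by
        rw [Finset.sum_mul]; exact Finset.sum_congr rfl fun t _ ↦ by ring
    _ = _ := by
        rw [h]
        by_cases hik : i = k
        · subst hik; simp [sq]
        · simp [hik]

theorem samplingError_diagonal {r : ℕ} (hr : 1 ≤ r) (U : Matrix (Fin m) (Fin d) ℝ)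
    (a : Fin d → ℝ) {p : Fin m → ℝ} (hp : ∀ t, 0 ≤ p t) (t : Fin r → Fin m) :
    samplingError U (diagonal a) (rowSamplingMatrix p t) =
      (r : ℝ)⁻¹ * ‖∑ j, ((p (t j))⁻¹ •
        vecMulVec (fun i ↦ U (t j) i * a i) (fun i ↦ U (t j) i * a i) - diagonal a ^ 2)‖ := by
  have hr' : (0 : ℝ) < r := by exact_mod_cast hr
  set Q := rowSamplingMatrix p t with hQ
  have hQU : ∀ j i, (Q * U * diagonal a) j i = (√((r : ℝ) * p (t j)))⁻¹ * (U (t j) i * a i) := by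
    intro j i
    rw [mul_diagonal, mul_apply, Finset.sum_eq_single (t j)]
    · simp [hQ, rowSamplingMatrix, mul_assoc]
    · intro b _ hb
      simp [hQ, rowSamplingMatrix, hb]
    · simp
  have hprod : diagonal a * Uᵀ * Qᵀ * Q * U * diagonal a =
      (Q * U * diagonal a)ᵀ * (Q * U * diagonal a) := by
    simp only [transpose_mul, diagonal_transpose, Matrix.mul_assoc]
  have hsum : diagonal a * Uᵀ * Qᵀ * Q * U * diagonal a = (r : ℝ)⁻¹ • ∑ j, (p (t j))⁻¹ •
      vecMulVec (fun i ↦ U (t j) i * a i) (fun i ↦ U (t j) i * a i) := by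
    rw [hprod]
    ext i k
    rw [mul_apply, Matrix.smul_apply, Matrix.sum_apply, smul_eq_mul, Finset.mul_sum]
    refine Finset.sum_congr rfl fun j _ ↦ ?_
    -- No positivity of `p (t j)` is needed: if it vanishes, both sides are zero because `0⁻¹ = 0`.
    have hsq := Real.mul_self_sqrt (mul_nonneg hr'.le (hp (t j)))
    rw [transpose_apply, hQU, hQU, Matrix.smul_apply, vecMulVec_apply, smul_eq_mul]
    calc _ = (√((r : ℝ) * p (t j)) * √((r : ℝ) * p (t j)))⁻¹ *
          ((U (t j) i * a i) * (U (t j) k * a k)) := by rw [mul_inv]; ring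
      _ = _ := by rw [hsq, mul_inv]; ring
  have e : diagonal a ^ 2 - diagonal a * Uᵀ * Qᵀ * Q * U * diagonal a =
      -((r : ℝ)⁻¹ • ∑ j, ((p (t j))⁻¹ •
        vecMulVec (fun i ↦ U (t j) i * a i) (fun i ↦ U (t j) i * a i) - diagonal a ^ 2)) := by
    rw [hsum, Finset.sum_sub_distrib, smul_sub, Finset.sum_const, Finset.card_univ,
      Fintype.card_fin, ← Nat.cast_smul_eq_nsmul ℝ, smul_smul, inv_mul_cancel₀ hr'.ne', one_smul,
      neg_sub]
  rw [samplingError, e, norm_neg, norm_smul, Real.norm_of_nonneg (inv_nonneg.2 hr'.le)]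

/-- The matrix Bernstein bound for row sampling with the diagonal weights `a`. Here `c` bounds the
squared norms of the rescaled rows and `b` is a lower bound of the squared weights. -/
theorem measureReal_samplingError_le {Ω : Type*} [MeasurableSpace Ω] {μ : Measure Ω}
    [IsProbabilityMeasure μ] {r : ℕ} (hr : 1 ≤ r) {U : Matrix (Fin m) (Fin d) ℝ}
    (hU : Uᵀ * U = 1) {a : Fin d → ℝ} {p : Fin m → ℝ} (hp : IsProbVector p) {c : ℝ}
    (hpc : ∀ t, ∑ i, (U t i * a i) ^ 2 ≤ p t * c)
    {τ : Fin r → Ω → Fin m} (hτ : IsIIDSample μ p τ) {b s R v η : ℝ} (hb0 : 0 ≤ b)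
    (hb : ∀ i, b ≤ a i ^ 2) (hs : ∀ i, a i ^ 2 ≤ s) (hc0 : 0 ≤ c)
    (hsR : s ≤ R) (hcR : c - b ≤ R) (hR0 : 0 ≤ R) (hv : c * s - b ^ 2 ≤ v) (hv0 : 0 < v)
    (hη : 0 < η) :
    μ.real {ω | η < samplingError U (diagonal a) (rowSamplingMatrix p fun j ↦ τ j ω)} ≤
      2 * d * Real.exp (-(r * η ^ 2) / (2 * (v + η * R / 3))) := by
  have hr' : (0 : ℝ) < r := by exact_mod_cast hr
  set w : Fin m → Fin d → ℝ := fun t i ↦ U t i * a i with hw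
  set W : Fin m → Matrix (Fin d) (Fin d) ℝ := fun t ↦ vecMulVec (w t) (w t) with hW
  set X : Fin m → Matrix (Fin d) (Fin d) ℝ := fun t ↦ (p t)⁻¹ • W t - diagonal a ^ 2 with hX
  have hww : ∀ t, w t ⬝ᵥ w t ≤ p t * c := fun t ↦ by
    simpa [hw, dotProduct, sq] using hpc t
  have hW0 : ∀ t, (W t).PosSemidef := fun t ↦ by
    simpa using posSemidef_vecMulVec_self_star (w t)
  -- A row that is never sampled must vanish, so the convention `0⁻¹ = 0` spoils neither the mean
  -- nor the variance.
  have hWp : ∀ t, p t = 0 → W t = 0 := fun t ht ↦ by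
    have h := hww t
    rw [ht, zero_mul] at h
    have hz : w t = 0 := dotProduct_self_eq_zero.1
      (le_antisymm h (Finset.sum_nonneg fun i _ ↦ mul_self_nonneg _))
    simp [hW, hz]
  have hWinv : ∀ t, p t • (p t)⁻¹ • W t = W t := fun t ↦ by
    by_cases ht : p t = 0
    · simp [hWp t ht]
    · rw [smul_inv_smul₀ ht]
  have hWsum : ∑ t, W t = diagonal a ^ 2 := sum_vecMulVec_scaled_rows hU a
  have hWc : ∀ t, (c • 1 - (p t)⁻¹ • W t).PosSemidef := fun t ↦ by
    by_cases ht : p t = 0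
    · simpa [hWp t ht] using PosSemidef.one.smul hc0
    · have h := (posSemidef_smul_one_sub_vecMulVec (hww t)).smul (inv_nonneg.2 (hp.1 t))
      rwa [smul_sub, smul_smul, inv_mul_cancel_left₀ ht] at h
  have hXsymm : ∀ t, (X t).IsSymm := fun t ↦ by
    have := (hW0 t).isHermitian
    rw [IsHermitian, conjTranspose_eq_transpose_of_trivial] at this
    exact (IsSymm.smul this _).sub ((isSymm_diagonal a).pow 2)
  have hmean : ∑ t, p t • X t = 0 := by
    simp only [hX, smul_sub, hWinv, Finset.sum_sub_distrib, hWsum, ← Finset.sum_smul, hp.2,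
      one_smul, sub_self]
  have hR1 : ∀ t, (R • 1 - X t).PosSemidef := fun t ↦ by
    have h : ((R - c) • 1 + diagonal a ^ 2).PosSemidef := by
      rw [diagonal_pow, smul_one_eq_diagonal, diagonal_add, posSemidef_diagonal_iff]
      intro i
      have := hb i
      simp only [Pi.pow_apply]
      linarith
    convert (hWc t).add h using 1
    simp only [hX]
    module
  have hR2 : ∀ t, (R • 1 + X t).PosSemidef := fun t ↦ by
    have h : (R • 1 - diagonal a ^ 2).PosSemidef := by
      rw [diagonal_pow, smul_one_eq_diagonal, diagonal_sub, posSemidef_diagonal_iff]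
      intro i
      have := hs i
      simp only [Pi.pow_apply]
      linarith
    convert ((hW0 t).smul (inv_nonneg.2 (hp.1 t))).add h using 1
    simp only [hX]
    module
  have hvar : (v • 1 - ∑ t, p t • X t ^ 2).PosSemidef := by
    have hexp : ∀ t, p t • X t ^ 2 = ((p t)⁻¹ * (w t ⬝ᵥ w t)) • W t - W t * diagonal a ^ 2
        - diagonal a ^ 2 * W t + p t • (diagonal a ^ 2 * diagonal a ^ 2) := fun t ↦ by
      have hWW : p t • ((p t)⁻¹ • W t * ((p t)⁻¹ • W t)) =
          ((p t)⁻¹ * (w t ⬝ᵥ w t)) • W t := by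
        rw [← smul_mul_assoc, hWinv, mul_smul_comm, mul_smul]
        congr 1
        simp only [hW]
        rw [vecMulVec_mul_vecMulVec]
        simp [vecMulVec_smul]
      have hWl : p t • ((p t)⁻¹ • W t * diagonal a ^ 2) = W t * diagonal a ^ 2 := by
        rw [← smul_mul_assoc, hWinv]
      have hWr : p t • (diagonal a ^ 2 * (p t)⁻¹ • W t) = diagonal a ^ 2 * W t := by
        rw [← mul_smul_comm, hWinv]
      simp only [hX, sq (_ - _), sub_mul, mul_sub, smul_sub, hWW, hWl, hWr]
      abel
    have hsum : ∑ t, p t • X t ^ 2 = ∑ t, ((p t)⁻¹ * (w t ⬝ᵥ w t)) • W t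
        - diagonal a ^ 2 * diagonal a ^ 2 := by
      simp only [hexp, Finset.sum_add_distrib, Finset.sum_sub_distrib, ← Finset.sum_mul,
        ← Finset.mul_sum, hWsum, ← Finset.sum_smul, hp.2, one_smul]
      abel
    have h1 : (∑ t, (c - (p t)⁻¹ * (w t ⬝ᵥ w t)) • W t).PosSemidef := by
      refine posSemidef_sum _ fun t _ ↦ (hW0 t).smul ?_
      by_cases ht : p t = 0
      · simpa [ht] using hc0
      · have hpt : 0 < p t := lt_of_le_of_ne (hp.1 t) (Ne.symm ht)
        rw [sub_nonneg, inv_mul_le_iff₀ hpt]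
        exact hww t
    -- Entrywise, `c a_i² - a_i⁴ ≤ c s - b² ≤ v`.
    have h2 : (v • 1 - c • diagonal a ^ 2 + diagonal a ^ 2 * diagonal a ^ 2).PosSemidef := by
      rw [diagonal_pow, smul_one_eq_diagonal, ← diagonal_smul, diagonal_sub,
        diagonal_mul_diagonal, diagonal_add, posSemidef_diagonal_iff]
      intro i
      have h3 := mul_le_mul_of_nonneg_left (hs i) hc0
      have h4 := mul_le_mul (hb i) (hb i) hb0 (sq_nonneg _)
      simp only [Pi.pow_apply, Pi.smul_apply, smul_eq_mul]
      linarith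
    convert h1.add h2 using 1
    rw [hsum]
    simp only [sub_smul, Finset.sum_sub_distrib, ← Finset.smul_sum, hWsum]
    abel
  classical
  rw [hτ.measureReal_setOf
    fun t ↦ η < samplingError U (diagonal a) (rowSamplingMatrix p t)]
  have hB := matrix_bernstein hp.1 hp.2 hXsymm hmean hR1 hR2 hvar hR0 hv0 hη r
  rw [Fintype.card_fin] at hB
  refine le_of_eq_of_le (Finset.sum_congr (Finset.filter_congr fun t _ ↦ ?_) fun _ _ ↦ rfl) hB
  rw [samplingError_diagonal hr U a hp.1 t, lt_inv_mul_iff₀ hr']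

end Sampling

/-! ### Choice of the Bernstein parameters and the final bounds. -/

theorem sum_mul_sq_le_of_isProb_lower_bound {m d : ℕ} {U : Matrix (Fin m) (Fin d) ℝ}
    {a : Fin d → ℝ} {p : Fin m → ℝ} {β : ℝ} (hβ : 0 < β) (hT : 0 < ∑ i, a i ^ 2)
    (h : ∀ t, β * (U t ⬝ᵥ (diagonal a ^ 2 *ᵥ U t) / (diagonal a ^ 2).trace) ≤ p t) (t : Fin m) :
    ∑ i, (U t i * a i) ^ 2 ≤ p t * ((∑ i, a i ^ 2) / β) := by
  have e1 : (diagonal a ^ 2).trace = ∑ i, a i ^ 2 := by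
    rw [diagonal_pow, trace_diagonal]
    rfl
  have e2 : U t ⬝ᵥ (diagonal a ^ 2 *ᵥ U t) = ∑ i, (U t i * a i) ^ 2 := by
    rw [diagonal_pow, dotProduct]
    refine Finset.sum_congr rfl fun i _ ↦ ?_
    rw [mulVec_diagonal, Pi.pow_apply]
    ring
  have ht := h t
  rw [e1, e2] at ht
  calc _ = β * ((∑ i, (U t i * a i) ^ 2) / ∑ i, a i ^ 2) * ((∑ i, a i ^ 2) / β) := by
        field_simp
    _ ≤ _ := by gcongr

theorem mainTheorem1 {Ω : Type*} [MeasurableSpace Ω] (μ : Measure Ω) [IsProbabilityMeasure μ]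
    {m d r : ℕ} (hd : 1 ≤ d) (hr : 1 ≤ r)
    (U : Matrix (Fin m) (Fin d) ℝ) (hU : Uᵀ * U = 1)
    (S : Matrix (Fin d) (Fin d) ℝ) (hS : S.IsDiag) (hSpos : ∀ i, 0 < S i i)
    (β ε : ℝ) (hβ : 0 < β) (hβ1 : β ≤ 1) (hε : 0 < ε)
    (p : Fin m → ℝ) (hp : IsProbVector p)
    (hpβ : ∀ t, β * (U t ⬝ᵥ (S ^ 2 *ᵥ U t) / (S ^ 2).trace) ≤ p t)
    (τ : Fin r → Ω → Fin m) (hτ : IsIIDSample μ p τ) :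
    -- the sampling theorem
    (ε ≤ 3 → ∀ δ : ℝ, 0 < δ →
      4 * stableRank S / (β * ε ^ 2) * Real.log (2 * d / δ) ≤ r →
      1 - δ ≤ μ.real {ω |
        samplingError U S (rowSamplingMatrix p fun j => τ j ω) ≤ ε * ‖S‖ ^ 2}) ∧
    -- the tail bound with the condition number
    (2 ≤ d →
      μ.real {ω | ε * ‖S‖ ^ 2 < samplingError U S (rowSamplingMatrix p fun j => τ j ω)}
        ≤ sharpTailBound S r β ε) ∧
    -- the simplified tail bound
    (ε ≤ 3 →
      μ.real {ω | ε * ‖S‖ ^ 2 < samplingError U S (rowSamplingMatrix p fun j => τ j ω)}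
        ≤ simpleTailBound S r β ε) ∧
    -- the comparison of the two bounds
    (2 ≤ d → ε ≤ 3 → sharpTailBound S r β ε ≤ simpleTailBound S r β ε) := by
  obtain ⟨a, rfl⟩ : ∃ a : Fin d → ℝ, S = diagonal a := ⟨_, hS.diagonal_diag.symm⟩
  have ha : ∀ i, 0 < a i := fun i ↦ by simpa using hSpos i
  obtain ⟨k, hk⟩ := exists_norm_diagonal_eq hd a
  have hs : ‖diagonal a‖ ^ 2 = a k ^ 2 := by rw [hk, sq_abs]
  have hs0 : 0 < a k ^ 2 := pow_pos (ha k) 2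
  have hle : ∀ i, a i ^ 2 ≤ a k ^ 2 := fun i ↦ by
    rw [← hs, ← sq_abs (a i)]
    exact pow_le_pow_left₀ (abs_nonneg _) (abs_le_norm_diagonal a i) 2
  have hkT : a k ^ 2 ≤ ∑ i, a i ^ 2 :=
    Finset.single_le_sum (f := fun i ↦ a i ^ 2) (fun i _ ↦ sq_nonneg _) (Finset.mem_univ k)
  have hT : 0 < ∑ i, a i ^ 2 := hs0.trans_le hkT
  have hpc := sum_mul_sq_le_of_isProb_lower_bound hβ hT hpβ
  set T := ∑ i, a i ^ 2 with hTdef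
  have hTβ : T ≤ T / β := le_div_self hT.le hβ hβ1
  have hρ : stableRank (diagonal a) = T / a k ^ 2 := by rw [stableRank_diagonal, hs]
  have hρ1 : 1 ≤ stableRank (diagonal a) := by rw [hρ]; exact (one_le_div₀ hs0).2 hkT
  set ρ := stableRank (diagonal a) with hρdef
  have hTρ : T = ρ * a k ^ 2 := by rw [hρ, div_mul_cancel₀ _ hs0.ne']
  have hr' : (0 : ℝ) < r := by exact_mod_cast hr
  have hd' : (0 : ℝ) < d := by exact_mod_cast hd
  -- From here on `κ` is the inverse square of the condition number.
  set κ := condNumber (diagonal a) ^ (-2 : ℤ) with hκ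
  have hκ4 : condNumber (diagonal a) ^ (-4 : ℤ) = κ ^ 2 := by
    rw [hκ, ← zpow_natCast, ← _root_.zpow_mul]
    rfl
  have hκ0 : 0 ≤ κ := by
    rw [hκ, _root_.zpow_neg]
    exact inv_nonneg.2 (by exact_mod_cast sq_nonneg (condNumber (diagonal a)))
  have hκle : ∀ i, κ * a k ^ 2 ≤ a i ^ 2 := fun i ↦ condNumber_zpow_neg_two_mul_le ha i k
  have hκ1 : κ ≤ 1 := by
    have := hκle k
    nlinarith
  -- A second diagonal entry adds at least `κ‖S‖²` to the trace of `S²`. This is where `d ≥ 2`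
  -- enters: it gives `s ≤ R` and `v > 0` for the sharp bound.
  have hκρ : 2 ≤ d → 1 + κ ≤ ρ / β := fun hd2 ↦ by
    have : Nontrivial (Fin d) := Fin.nontrivial_iff_two_le.2 hd2
    obtain ⟨l, hl⟩ := exists_ne k
    have h1 : a k ^ 2 + a l ^ 2 ≤ T := by
      rw [← Finset.sum_pair (f := fun i ↦ a i ^ 2) hl.symm]
      exact Finset.sum_le_univ_sum_of_nonneg fun i ↦ sq_nonneg _
    have h2 : (1 + κ) * a k ^ 2 ≤ ρ * a k ^ 2 := by linarith [hκle l]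
    exact (le_of_mul_le_mul_right h2 hs0).trans (le_div_self (by linarith) hβ hβ1)
  have hcomp : 2 ≤ d → 0 < ρ / β - κ ^ 2 + ε * (ρ / β - κ) / 3 := fun hd2 ↦ by
    have h1 := hκρ hd2
    have h2 : 0 ≤ ε * (ρ / β - κ) := mul_nonneg hε.le (by linarith)
    nlinarith
  have hsimple : ε ≤ 3 →
      μ.real {ω | ε * ‖diagonal a‖ ^ 2 <
        samplingError U (diagonal a) (rowSamplingMatrix p fun j => τ j ω)}
        ≤ simpleTailBound (diagonal a) r β ε := fun hε3 ↦ by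
    have h := measureReal_samplingError_le hr hU hp hpc hτ (b := 0) (s := a k ^ 2) (R := T / β)
      (v := T / β * a k ^ 2) (η := ε * a k ^ 2) le_rfl (fun i ↦ sq_nonneg _) hle (by positivity)
      (hkT.trans hTβ) (by simp) (by positivity) (by simp) (by positivity) (by positivity)
    rw [hs]
    refine h.trans ?_
    rw [simpleTailBound, ← hρdef]
    refine mul_le_mul_of_nonneg_left (Real.exp_le_exp.2 ?_) (by positivity)
    rw [hTρ, neg_div, neg_div, neg_le_neg_iff]
    calc r * β * ε ^ 2 / (4 * ρ) = r * (ε * a k ^ 2) ^ 2 / (4 * (ρ * a k ^ 2 / β * a k ^ 2)) := by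
          have := (ha k).ne'
          field_simp
      _ ≤ _ := by
          -- The denominator is `2(1 + ε/3)` times `ρ‖S‖⁴/β`, and `ε ≤ 3` makes the factor at most
          -- 4.
          refine div_le_div_of_nonneg_left (by positivity) (by positivity) ?_
          have : 0 ≤ ρ * a k ^ 2 / β * a k ^ 2 := by positivity
          have h3 : ε * a k ^ 2 * (ρ * a k ^ 2 / β) / 3 = ε / 3 * (ρ * a k ^ 2 / β * a k ^ 2) := by
            ring
          nlinarith
  refine ⟨fun hε3 δ hδ hrδ ↦ ?_, fun hd2 ↦ ?_, hsimple, fun hd2 hε3 ↦ ?_⟩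
  · have hbound : simpleTailBound (diagonal a) r β ε ≤ δ := by
      have h1 : Real.log (2 * d / δ) ≤ r * β * ε ^ 2 / (4 * ρ) := by
        rw [le_div_iff₀ (by positivity)]
        rw [div_mul_eq_mul_div, div_le_iff₀ (by positivity)] at hrδ
        linarith
      have h2 : 2 * d / δ ≤ Real.exp (r * β * ε ^ 2 / (4 * ρ)) :=
        (Real.log_le_iff_le_exp (by positivity)).1 h1
      rw [simpleTailBound, ← hρdef, neg_div, Real.exp_neg, ← div_eq_mul_inv,
        div_le_iff₀ (Real.exp_pos _)]
      rw [div_le_iff₀ hδ] at h2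
      linarith
    have hcompl := hτ.measureReal_setOf_add_compl fun t ↦
      samplingError U (diagonal a) (rowSamplingMatrix p t) ≤ ε * ‖diagonal a‖ ^ 2
    simp only [not_le] at hcompl
    linarith [hsimple hε3]
  · have h1 := hκρ hd2
    have h := measureReal_samplingError_le hr hU hp hpc hτ (b := κ * a k ^ 2) (s := a k ^ 2)
      (R := (ρ / β - κ) * a k ^ 2) (v := (ρ / β - κ ^ 2) * (a k ^ 2) ^ 2) (η := ε * a k ^ 2)
      (by positivity) hκle hle (by positivity) (by nlinarith)
      (le_of_eq (by rw [hTρ]; ring)) (mul_nonneg (by linarith) hs0.le)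
      (le_of_eq (by rw [hTρ]; ring)) (mul_pos (by nlinarith) (by positivity)) (by positivity)
    rw [hs]
    refine h.trans (le_of_eq ?_)
    rw [sharpTailBound, hκ4, ← hρdef, ← hκ]
    congr 2
    have h2 : 2 * ((ρ / β - κ ^ 2) * (a k ^ 2) ^ 2 + ε * a k ^ 2 * ((ρ / β - κ) * a k ^ 2) / 3) =
        (2 * (ρ / β - κ ^ 2 + ε * (ρ / β - κ) / 3)) * (a k ^ 2) ^ 2 := by ring
    rw [h2, mul_pow, ← mul_assoc, ← neg_mul, mul_div_mul_right _ _ (by positivity)]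
  · rw [sharpTailBound, simpleTailBound, hκ4, ← hρdef, ← hκ]
    have h1 := hκρ hd2
    have h2 := hcomp hd2
    refine mul_le_mul_of_nonneg_left (Real.exp_le_exp.2 ?_) (by positivity)
    rw [neg_div, neg_div, neg_le_neg_iff]
    calc r * β * ε ^ 2 / (4 * ρ) = r * ε ^ 2 / (2 * (ρ / β + ρ / β)) := by field_simp; ring
      _ ≤ _ := by
          refine div_le_div_of_nonneg_left (by positivity) (by positivity) ?_
          -- With `ε ≤ 3` the bracket in `B₁` is at most `2ρ/β - κ² - κ`, and the negative terms are
          -- dropped.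
          have : ε * (ρ / β - κ) ≤ 3 * (ρ / β - κ) :=
            mul_le_mul_of_nonneg_right hε3 (by linarith)
          nlinarith [sq_nonneg κ]
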